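/- Let $\mathbb{D}$ be the open unit disk and $\mathbb{T}$ the unit circle with arclength measure $|d\zeta|$. Let $\mathcal{N}^+$ be the Smirnov class of quotients $f/g$ of bounded analytic functions in $\mathbb{D}$ with $g$ outer. Here an outer function is a function of the form $z \mapsto c \exp\big( \frac{1}{2\pi} \int_{\mathbb{T}} \frac{\zeta+z}{\zeta-z}\, u(\zeta)\,|d\zeta| \big)$, $z \in \mathbb{D}$, with $|c|=1$ and $u$ real-valued and integrable on $\mathbb{T}$. Values on $\mathbb{T}$ are radial limits. Equip $\mathcal{N}^+$ with the metric \[ \|f-g\|_{\mathcal{N}^+} = \int_{\mathbb{T}} \log(1+|f-g|)\,|d\zeta|. \] The Pythagorean factorization of $h \in \mathcal{N}^+$ is $h = b/a$ in $\mathbb{D}$, where $a$ is the unique outer function with $a(0)>0$ and $|a|^2 = \frac{1}{|h|^2+1}$ almost everywhere on $\mathbb{T}$, and $b = ah$ (so $b=0$ and $a=1$ if $h=0$). Let $(h_n)_n$ be a sequence in $\mathcal{N}^+$ and let $h \in \mathcal{N}^+$, with Pythagorean factorizations $h_n = b_n/a_n$ and $h = b/a$. If $\|h_n - h\|_{\mathcal{N}^+}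 \to 0$, then the functions $a, b, a_n, b_n$ have radial limits almost everywhere on $\mathbb{T}$, and there is a subsequence $(n_k)_k$ such that \[ \lim_{k\to\infty} a_{n_k}(\zeta) = a(\zeta) \quad\text{and}\quad \lim_{k\to\infty} b_{n_k}(\zeta) = b(\zeta) \] for almost every $\zeta \in \mathbb{T}$. -/

import Mathlib

open Complex Filter Topology MeasureTheory Metric Set

/-- `P ζ` holds for almost every point `ζ` of the unit circle, with respect to arclength
(the circle being parametrized by `θ ↦ exp (θ i)`, `0 < θ ≤ 2π`). -/
def AECircle (P : ℂ → Prop) : Prop :=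
  ∀ᵐ θ ∂(volume.restrict (Ioc (0 : ℝ) (2 * Real.pi))), P (circleMap 0 1 θ)

/-- `f` has the radial limit `w` at the boundary point `ζ`. -/
def HasRadialLimit (f : ℂ → ℂ) (ζ w : ℂ) : Prop :=
  Tendsto (fun r : ℝ => f ((r : ℂ) * ζ)) (𝓝[<] 1) (𝓝 w)

/-- The boundary function of a function on the unit disk: its radial limit at `ζ`
(an arbitrary value at those `ζ` where the radial limit does not exist). -/
noncomputable def boundaryValue (f : ℂ → ℂ) (ζ : ℂ) : ℂ :=
  limUnder (𝓝[<] (1 : ℝ)) (fun r : ℝ => f ((r : ℂ) * ζ))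

/-- `f` is a bounded analytic function on the unit disk. -/
def IsHardyInfty (f : ℂ → ℂ) : Prop :=
  DifferentiableOn ℂ f (ball 0 1) ∧ ∃ C : ℝ, ∀ z ∈ ball (0 : ℂ) 1, ‖f z‖ ≤ C

/-- `f` is an outer function on the unit disk: there are a unimodular constant `c` and an
integrable real function `g` on the circle (which is then `log |f|` almost everywhere) with
`f z = c * exp ((1 / 2π) ∫ (ζ + z) / (ζ - z) * g ζ |dζ|)` in the disk. -/
def IsOuter (f : ℂ → ℂ) : Prop :=
  ∃ (c : ℂ) (g : ℂ → ℝ), ‖c‖ = 1 ∧ CircleIntegrable g 0 1 ∧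
    ∀ z ∈ ball (0 : ℂ) 1,
      f z = c * exp (Real.circleAverage (fun ζ => (ζ + z) / (ζ - z) * (g ζ : ℂ)) 0 1)

/-- The Smirnov class: quotients on the unit disk of bounded analytic functions with outer
denominator. -/
def IsSmirnov (h : ℂ → ℂ) : Prop :=
  ∃ f g : ℂ → ℂ, IsHardyInfty f ∧ IsHardyInfty g ∧ IsOuter g ∧
    ∀ z ∈ ball (0 : ℂ) 1, h z = f z / g z

/-- The metric of the Smirnov class, `∫ log (1 + |f - g|) |dζ|` over the unit circle. It is the
integral of a nonnegative function, hence taken with values in `[0, ∞]`; it is finite when `f`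
and `g` belong to the Smirnov class. -/
noncomputable def smirnovDist (f g : ℂ → ℂ) : ENNReal :=
  ∫⁻ θ in Ioc (0 : ℝ) (2 * Real.pi), ENNReal.ofReal
    (Real.log (1 + ‖boundaryValue f (circleMap 0 1 θ) - boundaryValue g (circleMap 0 1 θ)‖))

/-- `h = b / a` is the Pythagorean factorization of the function `h` of the Smirnov class:
`a` is the outer function with `a 0 > 0` and `|a|² = 1 / (|h|² + 1)` almost everywhere on the
circle, and `b` is the numerator, determined by `h = b / a` in the disk. That `b` is a unimodular
constant times the inner factor of `h` times the outer function of modulus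
`|h| / (|h|² + 1)^(1/2)` (if `h ≠ 0`) and that `|a|² + |b|² = 1` almost everywhere on the circle
are consequences; they are not assumed. For `h = 0` this gives `b = 0`, `a = 1`. -/
structure IsPythagoreanFactorization (h b a : ℂ → ℂ) : Prop where
  outer : IsOuter a
  pos : 0 < (a 0).re ∧ (a 0).im = 0
  norm_sq : AECircle fun ζ => ‖boundaryValue a ζ‖ ^ 2 = 1 / (‖boundaryValue h ζ‖ ^ 2 + 1)
  quotient : ∀ z ∈ ball (0 : ℂ) 1, h z = b z / a z

/-! Write `a = exp (H g)` and `a_n = exp (H g_n)` with `H` the Herglotz integral; the unimodular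
constants are `1` because `a 0, a_n 0 > 0`. The modulus condition says `exp (2 g) = 1 / (|h|² + 1)`
on the circle, and likewise for `g_n`, so an elementary inequality gives `|g_n - g| ≤ log (1 + |h_n
- h|)` almost everywhere (`abs_log_density_sub_le`). Hence `g_n → g` in `L¹`.

This controls the moduli. The arguments of `a_n` involve the harmonic conjugate, which is not
bounded on `L¹`; a Kolmogorov-type argument replaces boundedness. Split `g_n - g = v⁺ - v⁻`, so that
`a_n = a * G⁻ / G⁺` with `G± = exp (-H v±)` analytic and bounded by `1`. The mean value property and
Fatou's lemma give `∫ (1 - Re G±) ≤ 2π (1 - G± 0) ≤ ∫ v±`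
(`lintegral_one_sub_re_exp_neg_herglotzIntegral_le`), which tends to `0`. Along a subsequence `Re G±
→ 1` almost everywhere, and `|G±| ≤ 1` upgrades this to `G± → 1`. Thus `a_n → a`, and `b_n = a_n h_n
→ a h = b` once `h_n → h` along the same subsequence.

Existence of boundary values rests on Fatou's theorem, for Poisson integrals (moduli) and for
bounded analytic functions. Both cases reduce to one fact: the angular derivative of a Poisson
integral converges radially wherever the boundary function is differentiable
(`tendsto_integral_polarPoissonSlope_smul`). -/

/-! ### The Poisson kernel and its angular derivative. -/

/-- The Poisson kernel of the unit disk in polar coordinates. -/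
noncomputable def polarPoisson (r t : ℝ) : ℝ :=
  (1 - r ^ 2) / (1 - 2 * r * Real.cos t + r ^ 2)

/-- The negative of the angular derivative of the Poisson kernel. -/
noncomputable def polarPoissonSlope (r t : ℝ) : ℝ :=
  (1 - r ^ 2) * (2 * r * Real.sin t) / (1 - 2 * r * Real.cos t + r ^ 2) ^ 2

lemma polarPoisson_denom_pos {r : ℝ} (hr : r ∈ Ioo (0 : ℝ) 1) (t : ℝ) :
    0 < 1 - 2 * r * Real.cos t + r ^ 2 := by
  nlinarith [Real.cos_le_one t, hr.1, hr.2, mul_nonneg hr.1.le (sub_nonneg.2 (Real.cos_le_one t)),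
    pow_pos (sub_pos.2 hr.2) 2]

lemma hasDerivAt_polarPoisson {r : ℝ} (hr : r ∈ Ioo (0 : ℝ) 1) (t : ℝ) :
    HasDerivAt (polarPoisson r) (-polarPoissonSlope r t) t := by
  have h : HasDerivAt (fun t => 1 - 2 * r * Real.cos t + r ^ 2) (2 * r * Real.sin t) t := by
    simpa using (((Real.hasDerivAt_cos t).const_mul (2 * r)).const_sub 1).add_const (r ^ 2)
  convert! (hasDerivAt_const t (1 - r ^ 2)).div h (polarPoisson_denom_pos hr t).ne' using 1
  simp only [polarPoissonSlope]
  ring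

lemma continuous_polarPoisson {r : ℝ} (hr : r ∈ Ioo (0 : ℝ) 1) : Continuous (polarPoisson r) :=
  continuous_iff_continuousAt.2 fun t => (hasDerivAt_polarPoisson hr t).continuousAt

lemma continuous_polarPoissonSlope {r : ℝ} (hr : r ∈ Ioo (0 : ℝ) 1) :
    Continuous (polarPoissonSlope r) := by
  unfold polarPoissonSlope
  exact Continuous.div (by fun_prop) (by fun_prop)
    fun t => (pow_pos (polarPoisson_denom_pos hr t) 2).ne'

lemma poissonKernel_circleMap (r θ t : ℝ) :
    poissonKernel 0 (r * circleMap 0 1 θ) (circleMap 0 1 (θ + t)) = polarPoisson r t := by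
  have h1 : circleMap 0 1 (θ + t) - r * circleMap 0 1 θ
      = circleMap 0 1 θ * (circleMap 0 1 t - r) := by
    simp only [circleMap, zero_add, ofReal_one, one_mul, ofReal_add, add_mul, Complex.exp_add]
    ring
  have h2 : ‖circleMap 0 1 t - r‖ ^ 2 = 1 - 2 * r * Real.cos t + r ^ 2 := by
    rw [← normSq_eq_norm_sq, normSq_apply]
    simp only [circleMap_zero, ofReal_one, one_mul, sub_re, sub_im, exp_ofReal_mul_I_re,
      exp_ofReal_mul_I_im, ofReal_re, ofReal_im]
    nlinarith [Real.sin_sq_add_cos_sq t]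
  simp only [poissonKernel, sub_zero, h1, norm_mul, norm_circleMap_zero, abs_one, one_mul, h2,
    norm_real, Real.norm_eq_abs, mul_one, sq_abs, one_pow, polarPoisson]

lemma circleAverage_eq_integral_symm {E : Type*} [NormedAddCommGroup E] [NormedSpace ℝ E]
    (f : ℂ → E) (θ : ℝ) :
    Real.circleAverage f 0 1
      = (2 * Real.pi)⁻¹ • ∫ t in -Real.pi..Real.pi, f (circleMap 0 1 (θ + t)) := by
  have hp : Function.Periodic (fun t => f (circleMap 0 1 (t + θ))) (2 * Real.pi) := fun t => by
    simp only [add_right_comm t, periodic_circleMap 0 1 (t + θ)]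
  have := hp.intervalIntegral_add_eq 0 (-Real.pi)
  rw [Real.circleAverage_eq_integral_add θ]
  rw [← zero_add (2 * Real.pi), this, show -Real.pi + 2 * Real.pi = Real.pi by ring, zero_add]
  simp only [add_comm θ]

lemma mul_circleMap_mem_ball {r : ℝ} (hr : r ∈ Ioo (0 : ℝ) 1) (θ : ℝ) :
    (r : ℂ) * circleMap 0 1 θ ∈ ball (0 : ℂ) 1 := by
  simpa [abs_of_pos hr.1] using hr.2

lemma circleAverage_poissonKernel_smul_eq {E : Type*} [NormedAddCommGroup E] [NormedSpace ℝ E]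
    (f : ℂ → E) (r θ : ℝ) :
    Real.circleAverage (poissonKernel 0 (r * circleMap 0 1 θ) • f) 0 1 = (2 * Real.pi)⁻¹ •
      ∫ t in -Real.pi..Real.pi, polarPoisson r t • f (circleMap 0 1 (θ + t)) := by
  simp [circleAverage_eq_integral_symm _ θ, poissonKernel_circleMap]

lemma integral_polarPoisson {r : ℝ} (hr : r ∈ Ioo (0 : ℝ) 1) :
    ∫ t in -Real.pi..Real.pi, polarPoisson r t = 2 * Real.pi := by
  have h := DiffContOnCl.circleAverage_poissonKernel_smul (f := fun _ => (1 : ℂ)) (c := 0)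
    diffContOnCl_const (mul_circleMap_mem_ball hr 0)
  rw [circleAverage_poissonKernel_smul_eq] at h
  simp only [real_smul, mul_one, intervalIntegral.integral_ofReal] at h
  norm_cast at h
  field_simp at h
  linarith

lemma integral_polarPoissonSlope {r : ℝ} (hr : r ∈ Ioo (0 : ℝ) 1) :
    ∫ t in -Real.pi..Real.pi, polarPoissonSlope r t = 0 := by
  have := intervalIntegral.integral_eq_sub_of_hasDerivAt (a := -Real.pi) (b := Real.pi)
    (fun t _ => hasDerivAt_polarPoisson hr t)
    (continuous_polarPoissonSlope hr).neg.continuousOn.intervalIntegrable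
  simpa [polarPoisson] using this

/-- Integration by parts. This is the total mass of the kernel `t * polarPoissonSlope r t`, which
after division by `2π` is an approximate identity as `r → 1`. -/
lemma integral_polarPoissonSlope_mul_id {r : ℝ} (hr : r ∈ Ioo (0 : ℝ) 1) :
    ∫ t in -Real.pi..Real.pi, polarPoissonSlope r t * t
      = 2 * Real.pi * (1 - polarPoisson r Real.pi) := by
  have := intervalIntegral.integral_mul_deriv_eq_deriv_mul (a := -Real.pi) (b := Real.pi)
    (fun t _ => hasDerivAt_polarPoisson hr t) (fun t _ => hasDerivAt_id t)
    (continuous_polarPoissonSlope hr).neg.continuousOn.intervalIntegrable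
    (continuous_const.intervalIntegrable _ _)
  simp only [mul_one, id, neg_mul, intervalIntegral.integral_neg, integral_polarPoisson hr] at this
  have hs : polarPoisson r (-Real.pi) = polarPoisson r Real.pi := by simp [polarPoisson]
  rw [hs] at this
  linarith

lemma tendsto_polarPoisson_pi :
    Tendsto (fun r => polarPoisson r Real.pi) (𝓝[<] 1) (𝓝 0) := by
  have h : ContinuousAt (fun r => polarPoisson r Real.pi) 1 := by
    unfold polarPoisson
    refine ContinuousAt.div (by fun_prop) (by fun_prop) (by norm_num)
  have h0 : polarPoisson 1 Real.pi = 0 := by simp [polarPoisson]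
  simpa [h0] using h.tendsto.mono_left nhdsWithin_le_nhds

lemma Ioo_mem_nhdsLT_one {a : ℝ} (ha : a < 1) : ∀ᶠ r in 𝓝[<] (1 : ℝ), r ∈ Ioo a 1 :=
  Ioo_mem_nhdsLT ha

lemma polarPoissonSlope_mul_id_nonneg {r t : ℝ} (hr : r ∈ Ioo (0 : ℝ) 1)
    (ht : t ∈ Icc (-Real.pi) Real.pi) : 0 ≤ polarPoissonSlope r t * t := by
  have h : 0 ≤ Real.sin t * t := by
    rcases le_total 0 t with h | h
    · exact mul_nonneg (Real.sin_nonneg_of_nonneg_of_le_pi h ht.2) h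
    · exact mul_nonneg_of_nonpos_of_nonpos (Real.sin_nonpos_of_nonpos_of_neg_pi_le h ht.1) h
  have : polarPoissonSlope r t * t = (1 - r ^ 2) * (2 * r * (Real.sin t * t)) /
      (1 - 2 * r * Real.cos t + r ^ 2) ^ 2 := by
    unfold polarPoissonSlope; ring
  rw [this]
  have h1 : 0 ≤ 1 - r ^ 2 := by nlinarith [hr.1, hr.2]
  have := hr.1.le
  positivity

/-- Concentration at `0`: the bound vanishes as `r → 1`. The denominator is `(1 - r)² + 2r (1 - cos
t)`, and `r > 1/2` makes it at least `1 - cos δ`. -/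
lemma polarPoissonSlope_mul_id_le {r t δ : ℝ} (hr : r ∈ Ioo (1 / 2 : ℝ) 1)
    (ht : t ∈ Icc (-Real.pi) Real.pi) (hδ : 0 < δ) (hδt : δ ≤ |t|) :
    polarPoissonSlope r t * t ≤ (1 - r ^ 2) * (2 * Real.pi) / (1 - Real.cos δ) ^ 2 := by
  have htpi : |t| ≤ Real.pi := abs_le.2 ht
  have hcos : Real.cos t ≤ Real.cos δ := by
    rw [← Real.cos_abs t]
    exact Real.cos_le_cos_of_nonneg_of_le_pi hδ.le htpi hδt
  have hδ1 : 0 < 1 - Real.cos δ := by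
    have := Real.cos_lt_cos_of_nonneg_of_le_pi le_rfl (hδt.trans htpi) hδ
    simp at this; linarith
  have h1 : 0 ≤ 1 - r ^ 2 := by nlinarith [hr.1, hr.2]
  have : polarPoissonSlope r t * t = (1 - r ^ 2) * (2 * (r * (Real.sin t * t))) /
      (1 - 2 * r * Real.cos t + r ^ 2) ^ 2 := by
    unfold polarPoissonSlope; ring
  rw [this]
  have hst : Real.sin t * t ≤ Real.pi := by
    calc Real.sin t * t ≤ |Real.sin t| * |t| := by rw [← abs_mul]; exact le_abs_self _
      _ ≤ 1 * Real.pi := by gcongr; exact Real.abs_sin_le_one t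
      _ = _ := one_mul _
  gcongr
  · nlinarith [hr.1, hr.2, Real.pi_pos]
  · nlinarith [hr.1, hr.2, sq_nonneg (1 - r)]

/-- A crude bound uniform in `t`, used to differentiate under the integral sign at fixed `r`. -/
lemma abs_polarPoissonSlope_le {r : ℝ} (hr : r ∈ Ioo (0 : ℝ) 1) (t : ℝ) :
    |polarPoissonSlope r t| ≤ 2 / (1 - r) ^ 4 := by
  have h1 : 0 < 1 - r := sub_pos.2 hr.2
  have h2 : (1 - r) ^ 2 ≤ 1 - 2 * r * Real.cos t + r ^ 2 := by
    nlinarith [mul_nonneg hr.1.le (sub_nonneg.2 (Real.cos_le_one t))]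
  have h3 : 0 ≤ 1 - r ^ 2 := by nlinarith [hr.1, hr.2]
  rw [polarPoissonSlope, abs_div, abs_of_pos (pow_pos (polarPoisson_denom_pos hr t) 2), abs_mul,
    abs_mul, abs_of_nonneg h3, abs_of_pos (by linarith [hr.1] : 0 < 2 * r),
    show (1 - r) ^ 4 = ((1 - r) ^ 2) ^ 2 by ring]
  have h4 : 2 * r * |Real.sin t| ≤ 2 := by
    nlinarith [Real.abs_sin_le_one t, abs_nonneg (Real.sin t), hr.1, hr.2]
  have h5 : 0 ≤ 2 * r * |Real.sin t| := by have := hr.1.le; positivity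
  gcongr
  nlinarith [sq_nonneg r]

/-- The angular derivative of the Poisson integral of a continuous function converges radially to
the derivative of the function. -/
theorem tendsto_integral_polarPoissonSlope_smul {E : Type*} [NormedAddCommGroup E]
    [NormedSpace ℝ E] [CompleteSpace E] {g : ℝ → E} {L : E} (hg : Continuous g)
    (hd : HasDerivAt g L 0) :
    Tendsto (fun r => (2 * Real.pi)⁻¹ •
      ∫ t in -Real.pi..Real.pi, polarPoissonSlope r t • g t) (𝓝[<] 1) (𝓝 L) := by
  have hpi := Real.pi_pos
  have hle : -Real.pi ≤ Real.pi := by linarith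
  -- The slope kernel has mean zero, so `g t` may be replaced by `g t - g 0 = t * dslope g 0 t`. The
  -- factor `t` turns the kernel into a nonnegative approximate identity acting on a continuous
  -- function with value `L` at `0`.
  have hcont : Continuous (dslope g 0) := by
    refine continuous_iff_continuousAt.2 fun t => ?_
    rcases eq_or_ne t 0 with rfl | ht
    · exact continuousAt_dslope_same.2 hd.differentiableAt
    · exact (continuousAt_dslope_of_ne ht).2 hg.continuousAt
  have hpeak := tendsto_setIntegral_peak_smul_of_integrableOn_of_tendsto (μ := volume)
    (s := Icc (-Real.pi) Real.pi) (t := Icc (-Real.pi) Real.pi) (x₀ := 0) (l := 𝓝[<] (1 : ℝ))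
    (φ := fun r t => (2 * Real.pi)⁻¹ * (polarPoissonSlope r t * t)) (g := dslope g 0) (a := L)
    measurableSet_Icc measurableSet_Icc subset_rfl self_mem_nhdsWithin (by simp)
    (by
      filter_upwards [Ioo_mem_nhdsLT_one zero_lt_one] with r hr t ht
      have := polarPoissonSlope_mul_id_nonneg hr ht
      positivity)
    (by
      intro u hu h0
      obtain ⟨δ, hδ, hδu⟩ := Metric.isOpen_iff.1 hu 0 h0
      have hlim : Tendsto (fun r : ℝ => (2 * Real.pi)⁻¹ *
          ((1 - r ^ 2) * (2 * Real.pi) / (1 - Real.cos δ) ^ 2)) (𝓝[<] 1) (𝓝 0) := by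
        have : Continuous (fun r : ℝ => (2 * Real.pi)⁻¹ *
          ((1 - r ^ 2) * (2 * Real.pi) / (1 - Real.cos δ) ^ 2)) := by fun_prop
        have h := (this.tendsto 1).mono_left (nhdsWithin_le_nhds (s := Iio 1))
        simpa using h
      rw [Metric.tendstoUniformlyOn_iff]
      intro ε hε
      filter_upwards [Ioo_mem_nhdsLT_one (a := 1 / 2) (by norm_num), hlim.eventually_lt_const hε]
        with r hr hlt t ht
      have hδt : δ ≤ |t| := by
        by_contra! h
        exact ht.2 (hδu (by simpa using h))
      have h0 := polarPoissonSlope_mul_id_nonneg (r := r) ⟨by linarith [hr.1], hr.2⟩ ht.1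
      have h1 := polarPoissonSlope_mul_id_le hr ht.1 hδ hδt
      rw [Pi.zero_apply, dist_zero_left, Real.norm_of_nonneg (by positivity)]
      exact lt_of_le_of_lt (by gcongr) hlt)
    (by
      have h : Tendsto (fun r => 1 - polarPoisson r Real.pi) (𝓝[<] 1) (𝓝 1) := by
        simpa using tendsto_polarPoisson_pi.const_sub 1
      refine h.congr' ?_
      filter_upwards [Ioo_mem_nhdsLT_one zero_lt_one] with r hr
      rw [integral_Icc_eq_integral_Ioc, ← intervalIntegral.integral_of_le hle,
        intervalIntegral.integral_const_mul, integral_polarPoissonSlope_mul_id hr]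
      field_simp)
    (by
      filter_upwards [Ioo_mem_nhdsLT_one zero_lt_one] with r hr
      exact (continuous_const.mul ((continuous_polarPoissonSlope hr).mul
        continuous_id)).aestronglyMeasurable)
    (hcont.continuousOn.integrableOn_Icc)
    (by
      have := hcont.tendsto 0
      rw [dslope_same, hd.deriv] at this
      exact this.mono_left nhdsWithin_le_nhds)
  refine hpeak.congr' ?_
  filter_upwards [Ioo_mem_nhdsLT_one zero_lt_one] with r hr
  rw [integral_Icc_eq_integral_Ioc, ← intervalIntegral.integral_of_le hle]
  have hq := continuous_polarPoissonSlope hr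
  have : ∀ t, ((2 * Real.pi)⁻¹ * (polarPoissonSlope r t * t)) • dslope g 0 t
      = (2 * Real.pi)⁻¹ • (polarPoissonSlope r t • g t - polarPoissonSlope r t • g 0) := fun t => by
    have h := sub_smul_dslope g 0 t
    rw [sub_zero] at h
    rw [← smul_sub, ← h, smul_smul, smul_smul, mul_assoc]
  simp only [this]
  rw [intervalIntegral.integral_smul, intervalIntegral.integral_sub
    (Continuous.intervalIntegrable (by fun_prop) _ _)
    (Continuous.intervalIntegrable (by fun_prop) _ _),
    intervalIntegral.integral_smul_const, integral_polarPoissonSlope hr, zero_smul, sub_zero]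

/-! ### Fatou's theorems on radial limits. -/

lemma aeCircle_of_ae {P : ℂ → Prop} (h : ∀ᵐ θ : ℝ, P (circleMap 0 1 θ)) : AECircle P :=
  ae_restrict_of_ae h

lemma CircleIntegrable.intervalIntegrable_comp {E : Type*} [NormedAddCommGroup E] {φ : ℂ → E}
    (hφ : CircleIntegrable φ 0 1) (θ a b : ℝ) :
    IntervalIntegrable (fun t => φ (circleMap 0 1 (θ + t))) volume a b := by
  have hp : Function.Periodic (fun t => φ (circleMap 0 1 t)) (2 * Real.pi) :=
    fun t => by simp only [periodic_circleMap 0 1 t]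
  have h := hp.intervalIntegrable₀ Real.two_pi_pos.ne'
    (by simpa [CircleIntegrable] using hφ) (θ + a) (θ + b)
  simpa using h.comp_add_left θ

lemma locallyIntegrable_of_intervalIntegrable {E : Type*} [NormedAddCommGroup E] {U : ℝ → E}
    (hU : ∀ a b, IntervalIntegrable U volume a b) : LocallyIntegrable U := by
  intro x
  refine ⟨Ioc (x - 1) (x + 1), Ioc_mem_nhds (by linarith) (by linarith), ?_⟩
  exact (intervalIntegrable_iff_integrableOn_Ioc_of_le (by linarith)).1 (hU _ _)

/-- **Fatou's theorem**: the Poisson integral of an integrable function on the circle has the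
radial limits given by the function almost everywhere. -/
theorem ae_tendsto_circleAverage_poissonKernel {φ : ℂ → ℝ} (hφ : CircleIntegrable φ 0 1) :
    AECircle fun ζ => Tendsto (fun r : ℝ => Real.circleAverage (poissonKernel 0 (r * ζ) • φ) 0 1)
      (𝓝[<] 1) (𝓝 (φ ζ)) := by
  have hpi := Real.pi_pos
  have hU : ∀ a b, IntervalIntegrable (fun t => φ (circleMap 0 1 t)) volume a b := fun a b => by
    simpa using hφ.intervalIntegrable_comp 0 a b
  refine aeCircle_of_ae ?_
  -- Lebesgue differentiation: at almost every `θ` the primitive `Φ` below is differentiable at `0`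
  -- with derivative `φ ζ`.
  filter_upwards [LocallyIntegrable.ae_hasDerivAt_integral
    (locallyIntegrable_of_intervalIntegrable hU)] with θ hθ
  have hu := hφ.intervalIntegrable_comp θ
  set u : ℝ → ℝ := fun t => φ (circleMap 0 1 (θ + t)) with hudef
  set Φ : ℝ → ℝ := fun t => ∫ s in (0 : ℝ)..t, u s with hΦ
  have hΦc : Continuous Φ := intervalIntegral.continuous_primitive hu 0
  have hΦ0 : HasDerivAt Φ (φ (circleMap 0 1 θ)) 0 := by
    have h1 := (hθ θ)
    have h2 : HasDerivAt (fun t => ∫ s in θ..θ + t, φ (circleMap 0 1 s))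
        (φ (circleMap 0 1 θ)) 0 := HasDerivAt.comp_const_add θ 0 (by simpa using h1)
    refine h2.congr_of_eventuallyEq (Eventually.of_forall fun t => ?_)
    simp only [hΦ, hudef]
    rw [intervalIntegral.integral_comp_add_left (fun s => φ (circleMap 0 1 s)), add_zero]
  have hac : AbsolutelyContinuousOnInterval Φ (-Real.pi) Real.pi :=
    (hu (-Real.pi) Real.pi).absolutelyContinuousOnInterval_intervalIntegral
      (by rw [uIcc_of_le (by linarith)]; exact ⟨by linarith, hpi.le⟩)
  have hder : ∀ᵐ t : ℝ, deriv Φ t = u t := by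
    filter_upwards [LocallyIntegrable.ae_hasDerivAt_integral
      (locallyIntegrable_of_intervalIntegrable hu)] with t ht
    exact (ht 0).deriv
  -- The first summand is the boundary term of the integration by parts that moves the derivative
  -- from `Φ` to the kernel; it dies since the kernel vanishes at `π` in the limit.
  have hlim := (tendsto_polarPoisson_pi.mul_const
    ((2 * Real.pi)⁻¹ * (Φ Real.pi - Φ (-Real.pi)))).add
    (tendsto_integral_polarPoissonSlope_smul hΦc hΦ0)
  rw [zero_mul, zero_add] at hlim
  refine hlim.congr' ?_
  filter_upwards [Ioo_mem_nhdsLT_one zero_lt_one] with r hr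
  have hpc : ContDiff ℝ 1 (polarPoisson r) := by
    unfold polarPoisson
    exact ContDiff.div (by fun_prop) (by fun_prop) fun t => (polarPoisson_denom_pos hr t).ne'
  have hibp := hpc.contDiffOn.absolutelyContinuousOnInterval.integral_mul_deriv_eq_deriv_mul hac
  have hs : polarPoisson r (-Real.pi) = polarPoisson r Real.pi := by simp [polarPoisson]
  have hcongr : ∫ t in -Real.pi..Real.pi, polarPoisson r t * deriv Φ t
      = ∫ t in -Real.pi..Real.pi, polarPoisson r t * u t := by
    refine intervalIntegral.integral_congr_ae ?_
    filter_upwards [hder] with t ht _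
    rw [ht]
  have hd : ∀ t, deriv (polarPoisson r) t = -polarPoissonSlope r t :=
    fun t => (hasDerivAt_polarPoisson hr t).deriv
  simp only [hd, neg_mul, intervalIntegral.integral_neg, hcongr, hs] at hibp
  rw [circleAverage_poissonKernel_smul_eq]
  simp only [smul_eq_mul] at hibp ⊢
  change _ = (2 * Real.pi)⁻¹ * ∫ t in -Real.pi..Real.pi, polarPoisson r t * u t
  rw [hibp]
  ring

/-- **Fatou's theorem** for bounded analytic functions: the radial limits exist almost
everywhere. -/
theorem IsHardyInfty.ae_exists_hasRadialLimit {F : ℂ → ℂ} (hF : IsHardyInfty F) :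
    AECircle fun ζ => ∃ w, HasRadialLimit F ζ w := by
  obtain ⟨hd, C, hC⟩ := hF
  -- A primitive of a bounded analytic function is Lipschitz, so it extends to the closed disk and
  -- its boundary function is differentiable almost everywhere. `F` is recovered from the angular
  -- derivative of the primitive.
  obtain ⟨G₀, hG₀⟩ := hd.isExactOn_ball
  have hC0 : 0 ≤ C := (norm_nonneg _).trans (hC 0 (by simp))
  have hlip : LipschitzOnWith ⟨C, hC0⟩ G₀ (ball 0 1) :=
    (convex_ball (0 : ℂ) 1).lipschitzOnWith_of_nnnorm_hasDerivWithin_le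
      (fun z hz => (hG₀ z hz).hasDerivWithinAt) (fun z hz => hC z hz)
  obtain ⟨G, hG, hEq⟩ := hlip.extend_finite_dimension
  have hGd : ∀ z ∈ ball (0 : ℂ) 1, HasDerivAt G (F z) z := fun z hz =>
    (hG₀ z hz).congr_of_eventuallyEq ((hEq.symm).eventuallyEq_of_mem (isOpen_ball.mem_nhds hz))
  have hGc : DiffContOnCl ℂ G (ball 0 1) :=
    ⟨fun z hz => (hGd z hz).differentiableAt.differentiableWithinAt, hG.continuous.continuousOn⟩
  have hγ := hG.comp (lipschitzWith_circleMap 0 1)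
  set γ : ℝ → ℂ := G ∘ circleMap 0 1 with hγdef
  have hγcont := hγ.continuous
  clear_value γ
  refine aeCircle_of_ae ?_
  filter_upwards [hγ.ae_differentiableAt_real] with θ hθ
  have hγd : HasDerivAt (fun t => γ (θ + t)) (deriv γ θ) 0 :=
    HasDerivAt.comp_const_add θ 0 (by simpa using hθ.hasDerivAt)
  have hγc : Continuous fun t => γ (θ + t) := hγcont.comp (by fun_prop)
  have hlim := tendsto_integral_polarPoissonSlope_smul hγc hγd
  have hmain : Tendsto (fun r : ℝ => (I * (r * circleMap 0 1 θ)) * F (r * circleMap 0 1 θ))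
      (𝓝[<] 1) (𝓝 (deriv γ θ)) := by
    refine hlim.congr' ?_
    filter_upwards [Ioo_mem_nhdsLT_one zero_lt_one] with r hr
    have h1 : HasDerivAt (fun s : ℝ => G (r * circleMap 0 1 (θ + s)))
        (F (r * circleMap 0 1 θ) * (r * (circleMap 0 1 θ * I))) 0 := by
      have h2 : HasDerivAt (fun s : ℝ => (r : ℂ) * circleMap 0 1 (θ + s))
          (r * (circleMap 0 1 θ * I)) 0 := by
        refine HasDerivAt.const_mul (r : ℂ) ?_
        have := hasDerivAt_circleMap 0 1 (θ + 0)
        rw [add_zero] at this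
        exact HasDerivAt.comp_const_add θ 0 (by simpa using this)
      have h3 := hGd _ (mul_circleMap_mem_ball hr (θ + 0))
      have h4 := HasDerivAt.scomp (𝕜 := ℝ) (𝕜' := ℂ) 0 h3 h2
      simpa [mul_comm, Function.comp_def] using h4
    -- The rotation `s` is moved onto the smooth kernel, so that differentiation in `s` does not
    -- touch `γ`.
    have hrepr : ∀ s : ℝ, G (r * circleMap 0 1 (θ + s)) = (2 * Real.pi)⁻¹ •
        ∫ t in -Real.pi..Real.pi, polarPoisson r (t - s) • γ (θ + t) := by
      intro s
      rw [← hGc.circleAverage_poissonKernel_smul (mul_circleMap_mem_ball hr (θ + s)),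
        circleAverage_eq_integral_symm _ θ]
      congr 1
      refine intervalIntegral.integral_congr fun t _ => ?_
      have := poissonKernel_circleMap r (θ + s) (t - s)
      rw [show θ + s + (t - s) = θ + t by ring] at this
      simp [this, hγdef]
    have h2 : HasDerivAt (fun s : ℝ => G (r * circleMap 0 1 (θ + s))) ((2 * Real.pi)⁻¹ •
        ∫ t in -Real.pi..Real.pi, polarPoissonSlope r t • γ (θ + t)) 0 := by
      simp only [hrepr]
      have hp := continuous_polarPoisson hr
      have hq := continuous_polarPoissonSlope hr
      have := (intervalIntegral.hasDerivAt_integral_of_dominated_loc_of_deriv_le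
        (F := fun s t => polarPoisson r (t - s) • γ (θ + t))
        (F' := fun s t => polarPoissonSlope r (t - s) • γ (θ + t))
        (bound := fun t => 2 / (1 - r) ^ 4 * ‖γ (θ + t)‖) (x₀ := (0 : ℝ)) (s := univ)
        (a := -Real.pi) (b := Real.pi) (μ := volume) univ_mem
        (Eventually.of_forall fun s => (Continuous.aestronglyMeasurable (by fun_prop)))
        (Continuous.intervalIntegrable (by fun_prop) _ _)
        (Continuous.aestronglyMeasurable (by fun_prop))
        (Eventually.of_forall fun t _ s _ => ?_)
        (Continuous.intervalIntegrable (by fun_prop) _ _)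
        (Eventually.of_forall fun t _ s _ => ?_)).2
      · simp only [sub_zero] at this
        exact this.const_smul (2 * Real.pi)⁻¹
      · rw [norm_smul]
        gcongr
        exact abs_polarPoissonSlope_le hr _
      · have h := (hasDerivAt_polarPoisson hr (t - s)).scomp s ((hasDerivAt_id s).const_sub t)
        simpa using h.smul_const (γ (θ + t))
    rw [h2.unique h1]
    ring
  have hne : circleMap 0 1 θ ≠ 0 := circleMap_ne_center one_ne_zero
  have hinv : Tendsto (fun r : ℝ => (I * (r * circleMap 0 1 θ))⁻¹) (𝓝[<] 1)
      (𝓝 (I * (1 * circleMap 0 1 θ))⁻¹) := by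
    refine Tendsto.inv₀ ?_ (by simp [hne])
    have : Continuous fun r : ℝ => I * ((r : ℂ) * circleMap 0 1 θ) := by fun_prop
    simpa using (this.tendsto 1).mono_left nhdsWithin_le_nhds
  refine ⟨_, (hinv.mul hmain).congr' ?_⟩
  filter_upwards [Ioo_mem_nhdsLT_one zero_lt_one] with r hr
  have : (r : ℂ) ≠ 0 := by exact_mod_cast hr.1.ne'
  field_simp

/-! ### Radial limits, Herglotz integrals and outer functions. -/

lemma AECircle.mono {P Q : ℂ → Prop} (hP : AECircle P) (h : ∀ ζ, ‖ζ‖ = 1 → P ζ → Q ζ) :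
    AECircle Q :=
  Eventually.mono hP fun θ hθ => h _ (by simp) hθ

lemma AECircle.and {P Q : ℂ → Prop} (hP : AECircle P) (hQ : AECircle Q) :
    AECircle fun ζ => P ζ ∧ Q ζ :=
  Eventually.and hP hQ

lemma HasRadialLimit.boundaryValue_eq {f : ℂ → ℂ} {ζ w : ℂ} (h : HasRadialLimit f ζ w) :
    boundaryValue f ζ = w :=
  Tendsto.limUnder_eq h

lemma HasRadialLimit.hasRadialLimit_boundaryValue {f : ℂ → ℂ} {ζ w : ℂ}
    (h : HasRadialLimit f ζ w) : HasRadialLimit f ζ (boundaryValue f ζ) :=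
  h.boundaryValue_eq.symm ▸ h

lemma mul_mem_ball_of_norm_eq_one {r : ℝ} (hr : r ∈ Ioo (0 : ℝ) 1) {ζ : ℂ} (hζ : ‖ζ‖ = 1) :
    (r : ℂ) * ζ ∈ ball (0 : ℂ) 1 := by
  simpa [abs_of_pos hr.1, hζ] using hr.2

lemma HasRadialLimit.congr {f g : ℂ → ℂ} {ζ w : ℂ} (hζ : ‖ζ‖ = 1)
    (hfg : ∀ z ∈ ball (0 : ℂ) 1, f z = g z) (h : HasRadialLimit f ζ w) : HasRadialLimit g ζ w := by
  refine Tendsto.congr' ?_ h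
  filter_upwards [Ioo_mem_nhdsLT_one zero_lt_one] with r hr
  exact hfg _ (mul_mem_ball_of_norm_eq_one hr hζ)

/-- The Herglotz integral of a real function on the unit circle. -/
noncomputable def herglotzIntegral (g : ℂ → ℝ) (z : ℂ) : ℂ :=
  Real.circleAverage (fun ζ => (ζ + z) / (ζ - z) * (g ζ : ℂ)) 0 1

lemma herglotzIntegral_eq (g : ℂ → ℝ) (z : ℂ) : herglotzIntegral g z =
    Real.circleAverage (fun ζ => herglotzRieszKernel 0 z ζ • (g ζ : ℂ)) 0 1 := by
  simp [herglotzIntegral, herglotzRieszKernel]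

lemma CircleIntegrable.ofReal {g : ℂ → ℝ} (hg : CircleIntegrable g 0 1) :
    CircleIntegrable (fun ζ => (g ζ : ℂ)) 0 1 := by
  simp only [CircleIntegrable, intervalIntegrable_iff] at hg ⊢
  exact Complex.ofRealCLM.integrable_comp hg

lemma circleIntegrable_herglotz {g : ℂ → ℝ} (hg : CircleIntegrable g 0 1) {z : ℂ}
    (hz : z ∈ ball (0 : ℂ) 1) :
    CircleIntegrable (fun ζ => (ζ + z) / (ζ - z) * (g ζ : ℂ)) 0 1 := by
  have := hg.ofReal.continuousOn_smul (continuousOn_herglotzRieszKernel_sphere hz)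
  simpa [herglotzRieszKernel_fun_def] using! this

lemma herglotzIntegral_sub {g₁ g₂ : ℂ → ℝ} (h₁ : CircleIntegrable g₁ 0 1)
    (h₂ : CircleIntegrable g₂ 0 1) {z : ℂ} (hz : z ∈ ball (0 : ℂ) 1) :
    herglotzIntegral (fun ζ => g₁ ζ - g₂ ζ) z = herglotzIntegral g₁ z - herglotzIntegral g₂ z := by
  simp only [herglotzIntegral]
  rw [← Real.circleAverage_fun_sub (circleIntegrable_herglotz h₁ hz)
    (circleIntegrable_herglotz h₂ hz)]
  simp only [ofReal_sub, mul_sub]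

lemma herglotzIntegral_zero (g : ℂ → ℝ) :
    herglotzIntegral g 0 = (Real.circleAverage g 0 1 : ℝ) := by
  have h : ∀ θ, (circleMap 0 1 θ + 0) / (circleMap 0 1 θ - 0) = (1 : ℂ) := fun θ => by
    rw [add_zero, sub_zero, div_self (circleMap_ne_center one_ne_zero)]
  simp only [herglotzIntegral, Real.circleAverage, h, one_mul]
  rw [intervalIntegral.integral_ofReal]
  simp

lemma re_herglotzIntegral {g : ℂ → ℝ} (hg : CircleIntegrable g 0 1) {z : ℂ}
    (hz : z ∈ ball (0 : ℂ) 1) :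
    (herglotzIntegral g z).re = Real.circleAverage (poissonKernel 0 z • g) 0 1 := by
  rw [herglotzIntegral_eq, re_circleAverage_herglotzRieszKernel_smul hg hz,
    poissonKernel_eq_re_herglotzRieszKernel]

lemma differentiableOn_herglotzIntegral {g : ℂ → ℝ} (hg : CircleIntegrable g 0 1) :
    DifferentiableOn ℂ (herglotzIntegral g) (ball 0 1) := by
  have := differentiableOn_circleAverage_herglotzRieszKernel_smul hg.ofReal
  simpa only [← herglotzIntegral_eq] using this

lemma norm_exp_neg_herglotzIntegral_le_one {v : ℂ → ℝ} (hv : CircleIntegrable v 0 1)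
    (h0 : ∀ ζ, 0 ≤ v ζ) {z : ℂ} (hz : z ∈ ball (0 : ℂ) 1) :
    ‖exp (-herglotzIntegral v z)‖ ≤ 1 := by
  rw [norm_exp, neg_re, re_herglotzIntegral hv hz, Real.exp_le_one_iff, neg_nonpos]
  refine Real.circleAverage_nonneg_of_nonneg fun ζ hζ => ?_
  have h1 : ‖ζ‖ = 1 := by simpa using hζ
  have h2 : ‖z‖ < 1 := by simpa using hz
  refine mul_nonneg ?_ (h0 ζ)
  rw [poissonKernel, sub_zero, sub_zero, h1]
  refine div_nonneg ?_ (sq_nonneg _)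
  nlinarith [norm_nonneg z]

lemma isHardyInfty_exp_neg_herglotzIntegral {v : ℂ → ℝ} (hv : CircleIntegrable v 0 1)
    (h0 : ∀ ζ, 0 ≤ v ζ) : IsHardyInfty fun z => exp (-herglotzIntegral v z) :=
  ⟨(differentiableOn_herglotzIntegral hv).neg.cexp, 1,
    fun _ hz => norm_exp_neg_herglotzIntegral_le_one hv h0 hz⟩

/-- The modulus of `exp (H g)` is the exponential of the Poisson integral of `g`, so Fatou's theorem
for Poisson integrals identifies it. -/
lemma ae_norm_eq_of_hasRadialLimit {g : ℂ → ℝ} (hg : CircleIntegrable g 0 1) :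
    AECircle fun ζ => ∀ w, HasRadialLimit (fun z => exp (herglotzIntegral g z)) ζ w →
      ‖w‖ = Real.exp (g ζ) := by
  refine (ae_tendsto_circleAverage_poissonKernel hg).mono fun ζ hζ h w hw => ?_
  refine tendsto_nhds_unique hw.norm ((Real.continuous_exp.tendsto _).comp h |>.congr' ?_)
  filter_upwards [Ioo_mem_nhdsLT_one zero_lt_one] with r hr
  rw [norm_exp, re_herglotzIntegral hg (mul_mem_ball_of_norm_eq_one hr hζ), Function.comp]

lemma CircleIntegrable.posPart {g : ℂ → ℝ} (hg : CircleIntegrable g 0 1) :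
    CircleIntegrable (fun ζ => max (g ζ) 0) 0 1 := by
  simp only [CircleIntegrable, intervalIntegrable_iff] at hg ⊢
  exact hg.pos_part

lemma CircleIntegrable.negPart {g : ℂ → ℝ} (hg : CircleIntegrable g 0 1) :
    CircleIntegrable (fun ζ => max (-g ζ) 0) 0 1 := by
  simp only [CircleIntegrable, intervalIntegrable_iff] at hg ⊢
  exact hg.neg_part

lemma ae_radialLimit_exp_neg_herglotzIntegral {v : ℂ → ℝ} (hv : CircleIntegrable v 0 1)
    (h0 : ∀ ζ, 0 ≤ v ζ) :
    AECircle fun ζ => ∃ w, HasRadialLimit (fun z => exp (-herglotzIntegral v z)) ζ w ∧ w ≠ 0 := by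
  have hn : CircleIntegrable (fun ζ => -v ζ) 0 1 := hv.neg
  refine ((isHardyInfty_exp_neg_herglotzIntegral hv h0).ae_exists_hasRadialLimit.and
    (ae_norm_eq_of_hasRadialLimit hn)).mono fun ζ _ h => ?_
  obtain ⟨⟨w, hw⟩, h⟩ := h
  have h1 : herglotzIntegral (fun ζ => -v ζ) = fun z => -herglotzIntegral v z := by
    ext z
    simp only [herglotzIntegral, Real.circleAverage, ofReal_neg, mul_neg,
      intervalIntegral.integral_neg, smul_neg]
  rw [h1] at h
  exact ⟨w, hw, norm_pos_iff.1 (by rw [h w hw]; exact Real.exp_pos _)⟩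

/-- Splitting `g - g₀` into positive and negative parts compares two outer functions through a
quotient of functions bounded by `1`. With `g₀ = 0` it yields radial limits of outer functions; with
two log-densities it compares `a_n` to `a`. -/
lemma exp_herglotzIntegral_eq_div {g g₀ : ℂ → ℝ} (hg : CircleIntegrable g 0 1)
    (hg₀ : CircleIntegrable g₀ 0 1) {z : ℂ} (hz : z ∈ ball (0 : ℂ) 1) :
    exp (herglotzIntegral g z) = exp (herglotzIntegral g₀ z) *
      (exp (-herglotzIntegral (fun ζ => max (-(g ζ - g₀ ζ)) 0) z) /
        exp (-herglotzIntegral (fun ζ => max (g ζ - g₀ ζ) 0) z)) := by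
  have hd : CircleIntegrable (fun ζ => g ζ - g₀ ζ) 0 1 := hg.sub hg₀
  have h1 := herglotzIntegral_sub hd.posPart hd.negPart hz
  have h2 : (fun ζ => max (g ζ - g₀ ζ) 0 - max (-(g ζ - g₀ ζ)) 0) = fun ζ => g ζ - g₀ ζ := by
    ext ζ
    rcases le_total (g ζ - g₀ ζ) 0 with h | h
    · rw [max_eq_right h, max_eq_left (by linarith)]
      ring
    · rw [max_eq_left h, max_eq_right (by linarith), sub_zero]
  rw [h2, herglotzIntegral_sub hg hg₀ hz] at h1
  rw [← Complex.exp_sub, ← Complex.exp_add]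
  congr 1
  linear_combination h1

lemma HasRadialLimit.mul {f g : ℂ → ℂ} {ζ v w : ℂ} (hf : HasRadialLimit f ζ v)
    (hg : HasRadialLimit g ζ w) : HasRadialLimit (fun z => f z * g z) ζ (v * w) :=
  Tendsto.mul hf hg

lemma HasRadialLimit.div {f g : ℂ → ℂ} {ζ v w : ℂ} (hf : HasRadialLimit f ζ v)
    (hg : HasRadialLimit g ζ w) (hw : w ≠ 0) : HasRadialLimit (fun z => f z / g z) ζ (v / w) :=
  Tendsto.div hf hg hw

/-- An outer function has nonzero radial limits almost everywhere, whose modulus is given by the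
density in its Herglotz representation. -/
theorem ae_radialLimit_exp_herglotzIntegral {g : ℂ → ℝ} (hg : CircleIntegrable g 0 1) :
    AECircle fun ζ => ∃ w, HasRadialLimit (fun z => exp (herglotzIntegral g z)) ζ w ∧
      ‖w‖ = Real.exp (g ζ) := by
  have h0 : CircleIntegrable (fun _ => (0 : ℝ)) 0 1 := circleIntegrable_const 0 0 1
  have hd : CircleIntegrable (fun ζ => g ζ - 0) 0 1 := hg.sub h0
  have hz : ∀ z, herglotzIntegral (fun _ => 0) z = 0 := fun z => by
    simp [herglotzIntegral, Real.circleAverage]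
  refine (((ae_radialLimit_exp_neg_herglotzIntegral hd.posPart fun _ => le_max_right _ _).and
    (ae_radialLimit_exp_neg_herglotzIntegral hd.negPart fun _ => le_max_right _ _)).and
    (ae_norm_eq_of_hasRadialLimit hg)).mono fun ζ hζ h => ?_
  obtain ⟨⟨⟨v, hv, hv0⟩, w, hw, -⟩, h⟩ := h
  have hlim := (hw.div hv hv0).congr (g := fun z => exp (herglotzIntegral g z)) hζ fun z hz' => by
    rw [exp_herglotzIntegral_eq_div hg h0 hz', hz, Complex.exp_zero, one_mul]
  exact ⟨_, hlim, h _ hlim⟩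

lemma IsOuter.ae_hasRadialLimit {f : ℂ → ℂ} (hf : IsOuter f) :
    AECircle fun ζ => HasRadialLimit f ζ (boundaryValue f ζ) ∧ boundaryValue f ζ ≠ 0 := by
  obtain ⟨c, g, hc, hg, hfg⟩ := hf
  refine (ae_radialLimit_exp_herglotzIntegral hg).mono fun ζ hζ ⟨w, hw, hwn⟩ => ?_
  have h : HasRadialLimit f ζ (c * w) :=
    HasRadialLimit.congr hζ (fun z hz => (hfg z hz).symm) (Tendsto.const_mul c hw)
  refine ⟨h.hasRadialLimit_boundaryValue, ?_⟩
  rw [h.boundaryValue_eq]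
  refine mul_ne_zero (norm_pos_iff.1 (by rw [hc]; exact one_pos)) (norm_pos_iff.1 ?_)
  rw [hwn]
  exact Real.exp_pos _

lemma IsOuter.ne_zero {f : ℂ → ℂ} (hf : IsOuter f) {z : ℂ} (hz : z ∈ ball (0 : ℂ) 1) :
    f z ≠ 0 := by
  obtain ⟨c, g, hc, hg, hfg⟩ := hf
  rw [hfg z hz]
  exact mul_ne_zero (norm_pos_iff.1 (by rw [hc]; exact one_pos)) (Complex.exp_ne_zero _)

lemma IsSmirnov.ae_hasRadialLimit {h : ℂ → ℂ} (hh : IsSmirnov h) :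
    AECircle fun ζ => HasRadialLimit h ζ (boundaryValue h ζ) := by
  obtain ⟨f, g, hf, -, hg, hfg⟩ := hh
  refine (hf.ae_exists_hasRadialLimit.and hg.ae_hasRadialLimit).mono
    fun ζ hζ ⟨⟨w, hw⟩, hlim, hne⟩ => ?_
  exact ((hw.div hlim hne).congr hζ fun z hz => (hfg z hz).symm).hasRadialLimit_boundaryValue

lemma IsSmirnov.continuousOn {h : ℂ → ℂ} (hh : IsSmirnov h) : ContinuousOn h (ball 0 1) := by
  obtain ⟨f, g, hf, hg, hgo, hfg⟩ := hh
  exact (hf.1.continuousOn.div hg.1.continuousOn fun z hz => hgo.ne_zero hz).congr hfg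

/-! ### Measurability of boundary values and the mean estimate. -/

/-- Radii increasing to `1`. -/
noncomputable def radiusSeq (k : ℕ) : ℝ := 1 - 1 / ((k : ℝ) + 2)

lemma radiusSeq_mem (k : ℕ) : radiusSeq k ∈ Ioo (0 : ℝ) 1 := by
  have hk : (0 : ℝ) < (k : ℝ) + 2 := by positivity
  have h1 : 1 / ((k : ℝ) + 2) < 1 := by
    rw [div_lt_one hk]
    linarith [(Nat.cast_nonneg k : (0 : ℝ) ≤ k)]
  have h2 : 0 < 1 / ((k : ℝ) + 2) := by positivity
  exact ⟨by unfold radiusSeq; linarith, by unfold radiusSeq; linarith⟩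

lemma tendsto_radiusSeq : Tendsto radiusSeq atTop (𝓝[<] 1) := by
  refine tendsto_nhdsWithin_iff.2 ⟨?_, Eventually.of_forall fun k => (radiusSeq_mem k).2⟩
  have h : Tendsto (fun k : ℕ => 1 / ((k : ℝ) + 2)) atTop (𝓝 0) :=
    tendsto_const_nhds.div_atTop (tendsto_natCast_atTop_atTop.atTop_add tendsto_const_nhds)
  have h1 := h.const_sub 1
  rwa [sub_zero] at h1

lemma HasRadialLimit.tendsto_radiusSeq {f : ℂ → ℂ} {ζ w : ℂ} (h : HasRadialLimit f ζ w) :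
    Tendsto (fun k => f (radiusSeq k * ζ)) atTop (𝓝 w) :=
  Filter.Tendsto.comp (g := fun r : ℝ => f (r * ζ)) h _root_.tendsto_radiusSeq

lemma continuous_comp_mul_circleMap {f : ℂ → ℂ} (hf : ContinuousOn f (ball 0 1)) {r : ℝ}
    (hr : r ∈ Ioo (0 : ℝ) 1) : Continuous fun θ : ℝ => f (r * circleMap 0 1 θ) :=
  hf.comp_continuous (by fun_prop) fun θ => mul_circleMap_mem_ball hr θ

/-- Arclength measure in the angular parameter. -/
noncomputable abbrev angleMeasure : Measure ℝ := volume.restrict (Ioc (0 : ℝ) (2 * Real.pi))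

lemma aemeasurable_boundaryValue {f : ℂ → ℂ} (hf : ContinuousOn f (ball 0 1))
    (hlim : AECircle fun ζ => HasRadialLimit f ζ (boundaryValue f ζ)) :
    AEMeasurable (fun θ => boundaryValue f (circleMap 0 1 θ)) angleMeasure :=
  aemeasurable_of_tendsto_metrizable_ae atTop
    (fun k => (continuous_comp_mul_circleMap hf (radiusSeq_mem k)).aemeasurable)
    (Eventually.mono hlim fun _ h => h.tendsto_radiusSeq)

lemma circleAverage_mul_eq {F : ℂ → ℂ} (hF : DifferentiableOn ℂ F (ball 0 1)) {r : ℝ}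
    (hr : r ∈ Ioo (0 : ℝ) 1) :
    ∫ θ in (0 : ℝ)..2 * Real.pi, F (r * circleMap 0 1 θ) = 2 * Real.pi * F 0 := by
  have hd : DifferentiableOn ℂ F (closure (ball 0 |r|)) := hF.mono <| by
    rw [abs_of_pos hr.1, closure_ball _ hr.1.ne']
    exact closedBall_subset_ball hr.2
  have h := hd.diffContOnCl.circleAverage
  have h2 : ∀ θ, circleMap 0 r θ = r * circleMap 0 1 θ := fun θ => by simp [circleMap]
  rw [Real.circleAverage] at h
  simp only [h2, real_smul, ofReal_inv, ofReal_mul, ofReal_ofNat] at h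
  rw [← h]
  have : (Real.pi : ℂ) ≠ 0 := by exact_mod_cast Real.pi_ne_zero
  field_simp

/-- The boundary values of an analytic function bounded by `1` are close to `1` in the mean, if its
value at the origin is close to `1`. -/
theorem lintegral_one_sub_re_boundaryValue_le {F : ℂ → ℂ} (hF : DifferentiableOn ℂ F (ball 0 1))
    (hb : ∀ z ∈ ball (0 : ℂ) 1, ‖F z‖ ≤ 1)
    (hlim : AECircle fun ζ => HasRadialLimit F ζ (boundaryValue F ζ)) :
    ∫⁻ θ, ENNReal.ofReal (1 - (boundaryValue F (circleMap 0 1 θ)).re) ∂angleMeasure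
      ≤ ENNReal.ofReal (2 * Real.pi * (1 - (F 0).re)) := by
  -- By the mean value property, the integral is the same on every circle.
  have hint : ∀ k, ∫⁻ θ, ENNReal.ofReal (1 - (F (radiusSeq k * circleMap 0 1 θ)).re) ∂angleMeasure
      = ENNReal.ofReal (2 * Real.pi * (1 - (F 0).re)) := by
    intro k
    have hc := continuous_comp_mul_circleMap hF.continuousOn (radiusSeq_mem k)
    have hre : Continuous fun θ : ℝ => (F (radiusSeq k * circleMap 0 1 θ)).re :=
      continuous_re.comp hc
    rw [← ofReal_integral_eq_lintegral_ofReal]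
    · rw [← intervalIntegral.integral_of_le Real.two_pi_pos.le, intervalIntegral.integral_sub
        (continuous_const.intervalIntegrable _ _) (hre.intervalIntegrable _ _)]
      have h1 := congrArg re (circleAverage_mul_eq hF (radiusSeq_mem k))
      have h2 := intervalIntegral.intervalIntegral_re (𝕜 := ℂ) (μ := volume)
        (hc.intervalIntegrable 0 (2 * Real.pi))
      simp only [RCLike.re_eq_complex_re] at h2
      rw [h2, h1]
      simp [mul_sub]
    · exact ((continuous_const.sub hre).integrableOn_Icc).mono_set Ioc_subset_Icc_self
    · refine Eventually.of_forall fun θ => sub_nonneg.2 ?_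
      exact (re_le_norm _).trans (hb _ (mul_circleMap_mem_ball (radiusSeq_mem k) θ))
  -- Fatou's lemma, available because `|F| ≤ 1` makes `1 - Re F` nonnegative.
  calc _ = ∫⁻ θ, liminf (fun k => ENNReal.ofReal (1 - (F (radiusSeq k * circleMap 0 1 θ)).re))
        atTop ∂angleMeasure := by
        refine lintegral_congr_ae (Eventually.mono hlim fun θ h => ?_)
        have h1 := (continuous_re.tendsto _).comp h.tendsto_radiusSeq
        exact ((ENNReal.continuous_ofReal.tendsto _).comp (h1.const_sub 1)).liminf_eq.symm
    _ ≤ liminf (fun k => ∫⁻ θ, ENNReal.ofReal (1 - (F (radiusSeq k * circleMap 0 1 θ)).re)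
        ∂angleMeasure) atTop := by
        refine lintegral_liminf_le fun k => ?_
        have hc := continuous_comp_mul_circleMap hF.continuousOn (radiusSeq_mem k)
        exact (ENNReal.continuous_ofReal.comp
          (continuous_const.sub (continuous_re.comp hc))).measurable
    _ = _ := by simp only [hint, liminf_const]

/-- In the closed unit disk, `|w - 1|² = |w|² + 1 - 2 Re w ≤ 2 (1 - Re w)`. -/
lemma tendsto_one_of_re_tendsto_one {w : ℕ → ℂ} (hw : ∀ n, ‖w n‖ ≤ 1)
    (h : Tendsto (fun n => ENNReal.ofReal (1 - (w n).re)) atTop (𝓝 0)) :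
    Tendsto w atTop (𝓝 1) := by
  have hre : ∀ n, 0 ≤ 1 - (w n).re := fun n => sub_nonneg.2 ((re_le_norm _).trans (hw n))
  have h1 : Tendsto (fun n => 1 - (w n).re) atTop (𝓝 0) := by
    have := (ENNReal.tendsto_toReal ENNReal.zero_ne_top).comp h
    simpa [Function.comp_def, ENNReal.toReal_ofReal, hre] using this
  have h2 : Tendsto (fun n => √(2 * (1 - (w n).re))) atTop (𝓝 0) := by
    have := (Real.continuous_sqrt.tendsto _).comp (h1.const_mul 2)
    rwa [mul_zero, Real.sqrt_zero] at this
  refine tendsto_iff_norm_sub_tendsto_zero.2 (squeeze_zero (fun _ => norm_nonneg _)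
    (fun n => Real.le_sqrt_of_sq_le ?_) h2)
  have h3 : ‖w n‖ ^ 2 ≤ 1 := by nlinarith [norm_nonneg (w n), hw n]
  rw [← normSq_eq_norm_sq, normSq_apply] at h3 ⊢
  simp only [sub_re, sub_im, one_re, one_im]
  nlinarith

lemma tendsto_zero_of_log_one_add {d : ℕ → ℝ} (hd : ∀ n, 0 ≤ d n)
    (h : Tendsto (fun n => ENNReal.ofReal (Real.log (1 + d n))) atTop (𝓝 0)) :
    Tendsto d atTop (𝓝 0) := by
  have hl : ∀ n, 0 ≤ Real.log (1 + d n) := fun n => Real.log_nonneg (by linarith [hd n])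
  have h1 : Tendsto (fun n => Real.log (1 + d n)) atTop (𝓝 0) := by
    have := (ENNReal.tendsto_toReal ENNReal.zero_ne_top).comp h
    simpa [Function.comp_def, ENNReal.toReal_ofReal, hl] using this
  have h2 := ((Real.continuous_exp.tendsto _).comp h1).sub_const 1
  rw [Real.exp_zero, sub_self] at h2
  refine h2.congr fun n => ?_
  rw [Function.comp, Real.exp_log (by linarith [hd n])]
  ring

/-- Choose a subsequence whose integrals are below `2⁻ᵏ`: the sum of the series has finite integral,
hence is finite almost everywhere, and its terms tend to `0`. -/
lemma exists_subseq_ae_tendsto_zero_of_lintegral {α : Type*} [MeasurableSpace α] {μ : Measure α}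
    {f : ℕ → α → ENNReal} (hf : ∀ n, AEMeasurable (f n) μ)
    (h : Tendsto (fun n => ∫⁻ x, f n x ∂μ) atTop (𝓝 0)) :
    ∃ φ : ℕ → ℕ, StrictMono φ ∧ ∀ᵐ x ∂μ, Tendsto (fun k => f (φ k) x) atTop (𝓝 0) := by
  have hpos : ∀ k : ℕ, (0 : ENNReal) < 2⁻¹ ^ k := fun k => ENNReal.pow_pos (by simp) k
  obtain ⟨φ, hφ, hlt⟩ := extraction_forall_of_eventually
    (fun k => h.eventually_lt_const (hpos k))
  refine ⟨φ, hφ, ?_⟩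
  have hsum : ∫⁻ x, ∑' k, f (φ k) x ∂μ ≠ ⊤ := by
    rw [lintegral_tsum fun k => hf (φ k)]
    refine ne_top_of_le_ne_top ?_ (ENNReal.tsum_le_tsum fun k => (hlt k).le)
    rw [ENNReal.tsum_geometric]
    simp
  filter_upwards [ae_lt_top' (AEMeasurable.tsum fun k => hf (φ k)) hsum] with x hx
  exact ENNReal.tendsto_atTop_zero_of_tsum_ne_top hx.ne

lemma ae_hasRadialLimit_exp_neg_herglotzIntegral {v : ℂ → ℝ} (hv : CircleIntegrable v 0 1)
    (h0 : ∀ ζ, 0 ≤ v ζ) :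
    AECircle fun ζ => HasRadialLimit (fun z => exp (-herglotzIntegral v z)) ζ
      (boundaryValue (fun z => exp (-herglotzIntegral v z)) ζ) ∧
      boundaryValue (fun z => exp (-herglotzIntegral v z)) ζ ≠ 0 :=
  (ae_radialLimit_exp_neg_herglotzIntegral hv h0).mono fun _ _ ⟨_, hw, hne⟩ =>
    ⟨hw.hasRadialLimit_boundaryValue, hw.boundaryValue_eq.symm ▸ hne⟩

lemma HasRadialLimit.norm_le_one {F : ℂ → ℂ} {ζ w : ℂ} (h : HasRadialLimit F ζ w) (hζ : ‖ζ‖ = 1)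
    (hb : ∀ z ∈ ball (0 : ℂ) 1, ‖F z‖ ≤ 1) : ‖w‖ ≤ 1 := by
  refine le_of_tendsto (Filter.Tendsto.norm h) ?_
  filter_upwards [Ioo_mem_nhdsLT_one zero_lt_one] with r hr
  exact hb _ (mul_mem_ball_of_norm_eq_one hr hζ)

/-- Kolmogorov's estimate for the outer function of modulus `exp (-v)`, `0 ≤ v`. -/
theorem lintegral_one_sub_re_exp_neg_herglotzIntegral_le {v : ℂ → ℝ}
    (hv : CircleIntegrable v 0 1) (h0 : ∀ ζ, 0 ≤ v ζ) :
    ∫⁻ θ, ENNReal.ofReal (1 - (boundaryValue (fun z => exp (-herglotzIntegral v z))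
      (circleMap 0 1 θ)).re) ∂angleMeasure
      ≤ ∫⁻ θ, ENNReal.ofReal (v (circleMap 0 1 θ)) ∂angleMeasure := by
  refine (lintegral_one_sub_re_boundaryValue_le
    (differentiableOn_herglotzIntegral hv).neg.cexp
    (fun _ hz => norm_exp_neg_herglotzIntegral_le_one hv h0 hz)
    ((ae_hasRadialLimit_exp_neg_herglotzIntegral hv h0).mono fun _ _ h => h.1)).trans ?_
  have hi : Integrable (fun θ => v (circleMap 0 1 θ)) angleMeasure :=
    (intervalIntegrable_iff_integrableOn_Ioc_of_le Real.two_pi_pos.le).1 hv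
  rw [← ofReal_integral_eq_lintegral_ofReal hi (Eventually.of_forall fun θ => h0 _),
    ← intervalIntegral.integral_of_le Real.two_pi_pos.le]
  refine ENNReal.ofReal_le_ofReal ?_
  have h1 : (exp (-herglotzIntegral v 0)).re = Real.exp (-Real.circleAverage v 0 1) := by
    rw [herglotzIntegral_zero, ← ofReal_neg, exp_ofReal_re]
  have h2 : ∫ θ in (0 : ℝ)..2 * Real.pi, v (circleMap 0 1 θ)
      = 2 * Real.pi * Real.circleAverage v 0 1 := by
    rw [Real.circleAverage, smul_eq_mul, mul_inv_cancel_left₀ Real.two_pi_pos.ne']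
  rw [Pi.neg_apply, h1, h2]
  have := Real.one_sub_le_exp_neg (Real.circleAverage v 0 1)
  have := Real.two_pi_pos
  gcongr
  linarith

/-! ### Log-densities of Pythagorean factorizations. -/

lemma eq_one_of_norm_eq_one_of_mul_ofReal_pos {c : ℂ} {x : ℝ} (hc : ‖c‖ = 1) (hx : 0 < x)
    (hre : 0 < (c * x).re) (him : (c * x).im = 0) : c = 1 := by
  rw [re_mul_ofReal] at hre
  rw [im_mul_ofReal] at him
  have h1 : c.im = 0 := (mul_eq_zero.1 him).resolve_right hx.ne'
  have h2 : 0 < c.re := pos_of_mul_pos_left hre hx.le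
  have h3 : (c.re : ℂ) = c := Complex.ext (by simp) (by simp [h1])
  rw [← h3, norm_real, Real.norm_of_nonneg h2.le] at hc
  rw [← h3, hc, ofReal_one]

lemma IsPythagoreanFactorization.exists_herglotzIntegral {h b a : ℂ → ℂ}
    (hfac : IsPythagoreanFactorization h b a) :
    ∃ g : ℂ → ℝ, CircleIntegrable g 0 1 ∧
      (∀ z ∈ ball (0 : ℂ) 1, a z = exp (herglotzIntegral g z)) ∧
      AECircle fun ζ => Real.exp (g ζ) ^ 2 = 1 / (‖boundaryValue h ζ‖ ^ 2 + 1) := by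
  obtain ⟨c, g, hc, hg, hag⟩ := hfac.outer
  have h0 := hag 0 (by simp)
  change a 0 = c * exp (herglotzIntegral g 0) at h0
  rw [herglotzIntegral_zero, ← ofReal_exp] at h0
  obtain ⟨hre, him⟩ := hfac.pos
  rw [h0] at hre him
  obtain rfl := eq_one_of_norm_eq_one_of_mul_ofReal_pos hc (Real.exp_pos _) hre him
  have ha : ∀ z ∈ ball (0 : ℂ) 1, a z = exp (herglotzIntegral g z) := fun z hz => by
    rw [hag z hz, one_mul]
    rfl
  refine ⟨g, hg, ha, ((ae_radialLimit_exp_herglotzIntegral hg).and hfac.norm_sq).mono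
    fun ζ hζ ⟨⟨w, hw, hwn⟩, h⟩ => ?_⟩
  rw [← h, ← hwn, (hw.congr hζ fun z hz => (ha z hz).symm).boundaryValue_eq]

/-- After exponentiating and squaring, with `d = |u - w|`, this is `|w|² + 1 ≤ (1 + d)² (|u|² + 1)`.
It follows from `|w| ≤ |u| + d` and `2|u| ≤ |u|² + 1`. -/
lemma log_density_sub_le {s t : ℝ} {u w : ℂ} (hs : Real.exp s ^ 2 = 1 / (‖u‖ ^ 2 + 1))
    (ht : Real.exp t ^ 2 = 1 / (‖w‖ ^ 2 + 1)) : s - t ≤ Real.log (1 + ‖u - w‖) := by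
  have hd : 0 ≤ ‖u - w‖ := norm_nonneg _
  rw [Real.le_log_iff_exp_le (by positivity), Real.exp_sub, div_le_iff₀ (Real.exp_pos _)]
  refine le_of_sq_le_sq ?_ (by positivity)
  rw [mul_pow, hs, ht, mul_one_div, div_le_div_iff₀ (by positivity) (by positivity), one_mul]
  have h1 : ‖w‖ ≤ ‖u‖ + ‖u - w‖ := by
    have := norm_sub_le u (u - w)
    simpa using this
  have hu := norm_nonneg u
  nlinarith [pow_le_pow_left₀ (norm_nonneg w) h1 2, mul_nonneg hd (sq_nonneg (‖u‖ - 1)),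
    mul_nonneg (sq_nonneg ‖u - w‖) (sq_nonneg ‖u‖), mul_nonneg hd hu]

lemma abs_log_density_sub_le {s t : ℝ} {u w : ℂ} (hs : Real.exp s ^ 2 = 1 / (‖u‖ ^ 2 + 1))
    (ht : Real.exp t ^ 2 = 1 / (‖w‖ ^ 2 + 1)) : |s - t| ≤ Real.log (1 + ‖u - w‖) :=
  abs_sub_le_iff.2 ⟨log_density_sub_le hs ht, by
    rw [norm_sub_rev]; exact log_density_sub_le ht hs⟩

lemma IsPythagoreanFactorization.ae_hasRadialLimit {h b a : ℂ → ℂ} (hS : IsSmirnov h)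
    (hfac : IsPythagoreanFactorization h b a) :
    AECircle fun ζ => HasRadialLimit a ζ (boundaryValue a ζ) ∧
      HasRadialLimit b ζ (boundaryValue b ζ) ∧
      boundaryValue b ζ = boundaryValue a ζ * boundaryValue h ζ := by
  refine (hfac.outer.ae_hasRadialLimit.and hS.ae_hasRadialLimit).mono fun ζ hζ ⟨ha, hh⟩ => ?_
  have hb : HasRadialLimit b ζ (boundaryValue a ζ * boundaryValue h ζ) :=
    (ha.1.mul hh).congr hζ fun z hz => by
      rw [hfac.quotient z hz, mul_div_cancel₀ _ (hfac.outer.ne_zero hz)]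
  exact ⟨ha.1, hb.hasRadialLimit_boundaryValue, hb.boundaryValue_eq⟩

lemma aemeasurable_log_one_add_norm_boundaryValue_sub {f g : ℂ → ℂ} (hf : IsSmirnov f)
    (hg : IsSmirnov g) :
    AEMeasurable (fun θ => ENNReal.ofReal (Real.log (1 + ‖boundaryValue f (circleMap 0 1 θ) -
      boundaryValue g (circleMap 0 1 θ)‖))) angleMeasure :=
  (Real.measurable_log.comp_aemeasurable (((aemeasurable_boundaryValue hf.continuousOn
    hf.ae_hasRadialLimit).sub (aemeasurable_boundaryValue hg.continuousOn
    hg.ae_hasRadialLimit)).norm.const_add 1)).ennreal_ofReal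

lemma aemeasurable_one_sub_re_boundaryValue {v : ℂ → ℝ}
    (hv : CircleIntegrable v 0 1) (h0 : ∀ ζ, 0 ≤ v ζ) :
    AEMeasurable (fun θ => ENNReal.ofReal (1 - (boundaryValue
      (fun z => exp (-herglotzIntegral v z)) (circleMap 0 1 θ)).re)) angleMeasure :=
  ((measurable_re.comp_aemeasurable (aemeasurable_boundaryValue
    (differentiableOn_herglotzIntegral hv).neg.cexp.continuousOn
    ((ae_hasRadialLimit_exp_neg_herglotzIntegral hv h0).mono fun _ _ h => h.1))).const_sub
    1).ennreal_ofReal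

/-! ### Proof of the theorem. -/

theorem mainTheorem7
    (h b a : ℂ → ℂ) (hs bs as : ℕ → ℂ → ℂ)
    (hS : IsSmirnov h) (hsS : ∀ n, IsSmirnov (hs n))
    (hfac : IsPythagoreanFactorization h b a)
    (hsfac : ∀ n, IsPythagoreanFactorization (hs n) (bs n) (as n))
    (hconv : Tendsto (fun n => smirnovDist (hs n) h) atTop (𝓝 0)) :
    -- the boundary functions exist almost everywhere as radial limits,
    (AECircle fun ζ =>
      HasRadialLimit a ζ (boundaryValue a ζ) ∧ HasRadialLimit b ζ (boundaryValue b ζ) ∧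
      ∀ n, HasRadialLimit (as n) ζ (boundaryValue (as n) ζ) ∧
        HasRadialLimit (bs n) ζ (boundaryValue (bs n) ζ)) ∧
    -- and converge almost everywhere along a subsequence
    ∃ φ : ℕ → ℕ, StrictMono φ ∧ AECircle fun ζ =>
      Tendsto (fun k => boundaryValue (as (φ k)) ζ) atTop (𝓝 (boundaryValue a ζ)) ∧
      Tendsto (fun k => boundaryValue (bs (φ k)) ζ) atTop (𝓝 (boundaryValue b ζ)) := by
  have hlim := hfac.ae_hasRadialLimit hS
  have hslim : AECircle fun ζ => ∀ n, HasRadialLimit (as n) ζ (boundaryValue (as n) ζ) ∧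
      HasRadialLimit (bs n) ζ (boundaryValue (bs n) ζ) ∧
      boundaryValue (bs n) ζ = boundaryValue (as n) ζ * boundaryValue (hs n) ζ :=
    ae_all_iff.2 fun n => (hsfac n).ae_hasRadialLimit (hsS n)
  refine ⟨(hlim.and hslim).mono fun ζ _ hz => ⟨hz.1.1, hz.1.2.1, fun n =>
    ⟨(hz.2 n).1, (hz.2 n).2.1⟩⟩, ?_⟩
  obtain ⟨g, hg, hag, hgh⟩ := hfac.exists_herglotzIntegral
  choose gs hgs hags hgsh using fun n => (hsfac n).exists_herglotzIntegral
  set vp : ℕ → ℂ → ℝ := fun n ζ => max (gs n ζ - g ζ) 0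
  set vm : ℕ → ℂ → ℝ := fun n ζ => max (-(gs n ζ - g ζ)) 0
  have hd : ∀ n, CircleIntegrable (fun ζ => gs n ζ - g ζ) 0 1 := fun n => (hgs n).sub hg
  have hvpi : ∀ n, CircleIntegrable (vp n) 0 1 := fun n => (hd n).posPart
  have hvmi : ∀ n, CircleIntegrable (vm n) 0 1 := fun n => (hd n).negPart
  have hvp0 : ∀ n ζ, 0 ≤ vp n ζ := fun n ζ => le_max_right _ _
  have hvm0 : ∀ n ζ, 0 ≤ vm n ζ := fun n ζ => le_max_right _ _
  set Gp : ℕ → ℂ → ℂ := fun n z => exp (-herglotzIntegral (vp n) z)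
  set Gm : ℕ → ℂ → ℂ := fun n z => exp (-herglotzIntegral (vm n) z)
  have hle : ∀ n, AECircle fun ζ => |gs n ζ - g ζ| ≤
      Real.log (1 + ‖boundaryValue (hs n) ζ - boundaryValue h ζ‖) := fun n =>
    ((hgsh n).and hgh).mono fun ζ _ hz => abs_log_density_sub_le hz.1 hz.2
  have hGpl : ∀ n, AECircle fun ζ => HasRadialLimit (Gp n) ζ (boundaryValue (Gp n) ζ) ∧
      boundaryValue (Gp n) ζ ≠ 0 := fun n =>
    ae_hasRadialLimit_exp_neg_herglotzIntegral (hvpi n) (hvp0 n)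
  have hGml : ∀ n, AECircle fun ζ => HasRadialLimit (Gm n) ζ (boundaryValue (Gm n) ζ) ∧
      boundaryValue (Gm n) ζ ≠ 0 := fun n =>
    ae_hasRadialLimit_exp_neg_herglotzIntegral (hvmi n) (hvm0 n)
  set D : ℕ → ℝ → ENNReal := fun n θ => ENNReal.ofReal (Real.log
    (1 + ‖boundaryValue (hs n) (circleMap 0 1 θ) - boundaryValue h (circleMap 0 1 θ)‖))
  set Ep : ℕ → ℝ → ENNReal := fun n θ =>
    ENNReal.ofReal (1 - (boundaryValue (Gp n) (circleMap 0 1 θ)).re)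
  set Em : ℕ → ℝ → ENNReal := fun n θ =>
    ENNReal.ofReal (1 - (boundaryValue (Gm n) (circleMap 0 1 θ)).re)
  have hDm : ∀ n, AEMeasurable (D n) angleMeasure := fun n =>
    aemeasurable_log_one_add_norm_boundaryValue_sub (hsS n) hS
  have hEpm : ∀ n, AEMeasurable (Ep n) angleMeasure := fun n =>
    aemeasurable_one_sub_re_boundaryValue (hvpi n) (hvp0 n)
  have hEmm : ∀ n, AEMeasurable (Em n) angleMeasure := fun n =>
    aemeasurable_one_sub_re_boundaryValue (hvmi n) (hvm0 n)
  have hEpD : ∀ n, ∫⁻ θ, Ep n θ ∂angleMeasure ≤ ∫⁻ θ, D n θ ∂angleMeasure := fun n =>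
    (lintegral_one_sub_re_exp_neg_herglotzIntegral_le (hvpi n) (hvp0 n)).trans
      (lintegral_mono_ae (Eventually.mono (hle n) fun θ hθ => ENNReal.ofReal_le_ofReal
        (max_le ((le_abs_self _).trans hθ) ((abs_nonneg _).trans hθ))))
  have hEmD : ∀ n, ∫⁻ θ, Em n θ ∂angleMeasure ≤ ∫⁻ θ, D n θ ∂angleMeasure := fun n =>
    (lintegral_one_sub_re_exp_neg_herglotzIntegral_le (hvmi n) (hvm0 n)).trans
      (lintegral_mono_ae (Eventually.mono (hle n) fun θ hθ => ENNReal.ofReal_le_ofReal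
        (max_le ((neg_le_abs _).trans hθ) ((abs_nonneg _).trans hθ))))
  have hconv' : Tendsto (fun n => ∫⁻ θ, D n θ ∂angleMeasure) atTop (𝓝 0) := hconv
  -- Adding the three errors lets a single extraction serve `h_n`, `G⁺` and `G⁻` at once.
  have hsum : Tendsto (fun n => ∫⁻ θ, (D n θ + Ep n θ + Em n θ) ∂angleMeasure) atTop (𝓝 0) := by
    have h3 := (hconv'.add hconv').add hconv'
    rw [add_zero, add_zero] at h3
    refine tendsto_of_tendsto_of_tendsto_of_le_of_le tendsto_const_nhds h3
      (fun _ => zero_le) fun n => ?_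
    have hDE : AEMeasurable (fun θ => D n θ + Ep n θ) angleMeasure := (hDm n).add (hEpm n)
    rw [lintegral_add_left' hDE, lintegral_add_left' (hDm n)]
    exact add_le_add (add_le_add le_rfl (hEpD n)) (hEmD n)
  obtain ⟨φ, hφ, hae⟩ := exists_subseq_ae_tendsto_zero_of_lintegral
    (fun n => ((hDm n).add (hEpm n)).add (hEmm n)) hsum
  refine ⟨φ, hφ, ?_⟩
  have hGpl' := ae_all_iff.2 hGpl
  have hGml' := ae_all_iff.2 hGml
  unfold AECircle at hlim hslim ⊢
  filter_upwards [hae, hlim, hslim, hGpl', hGml'] with θ hθ hlim hslim hGpθ hGmθ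
  set ζ := circleMap 0 1 θ with hζdef
  have hζ : ‖ζ‖ = 1 := by simp [hζdef]
  have squeeze : ∀ {e : ℕ → ENNReal}, (∀ k, e k ≤ D (φ k) θ + Ep (φ k) θ + Em (φ k) θ) →
      Tendsto e atTop (𝓝 0) := fun he =>
    tendsto_of_tendsto_of_tendsto_of_le_of_le tendsto_const_nhds hθ (fun _ => zero_le) he
  have hh : Tendsto (fun k => boundaryValue (hs (φ k)) ζ) atTop (𝓝 (boundaryValue h ζ)) :=
    tendsto_iff_norm_sub_tendsto_zero.2 (tendsto_zero_of_log_one_add (fun _ => norm_nonneg _)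
      (squeeze fun k => (le_self_add).trans le_self_add))
  have hGp1 : Tendsto (fun k => boundaryValue (Gp (φ k)) ζ) atTop (𝓝 1) :=
    tendsto_one_of_re_tendsto_one (fun k => (hGpθ (φ k)).1.norm_le_one hζ
      fun _ hz => norm_exp_neg_herglotzIntegral_le_one (hvpi _) (hvp0 _) hz)
      (squeeze fun k => (le_add_self).trans le_self_add)
  have hGm1 : Tendsto (fun k => boundaryValue (Gm (φ k)) ζ) atTop (𝓝 1) :=
    tendsto_one_of_re_tendsto_one (fun k => (hGmθ (φ k)).1.norm_le_one hζ
      fun _ hz => norm_exp_neg_herglotzIntegral_le_one (hvmi _) (hvm0 _) hz)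
      (squeeze fun k => le_add_self)
  have ha : Tendsto (fun k => boundaryValue (as (φ k)) ζ) atTop (𝓝 (boundaryValue a ζ)) := by
    -- The factorization `a_n = a * G⁻ / G⁺` passes to radial limits because those of `G⁺` are
    -- nonzero.
    have h1 := (hGm1.div hGp1 one_ne_zero).const_mul (boundaryValue a ζ)
    rw [div_one, mul_one] at h1
    refine h1.congr fun k => ?_
    refine (HasRadialLimit.boundaryValue_eq (HasRadialLimit.congr hζ (fun z hz => ?_)
      (hlim.1.mul ((hGmθ (φ k)).1.div (hGpθ (φ k)).1 (hGpθ (φ k)).2)))).symm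
    rw [hag z hz, hags (φ k) z hz, exp_herglotzIntegral_eq_div (hgs (φ k)) hg hz]
  refine ⟨ha, ?_⟩
  rw [hlim.2.2]
  exact (ha.mul hh).congr fun k => ((hslim (φ k)).2.2).symm
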